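/- For a positive integer $m$, $X\in M_m(\mathbb{C})$ and a real number $p\ge 1$, let $\|X\|_p=\bigl(\sum_{j=1}^m s_j(X)^p\bigr)^{1/p}$ be the Schatten $p$-norm, where $s_1(X),\dots,s_m(X)$ are the singular values of $X$ counted with multiplicity. Let $\mathrm{Re}(X)=\tfrac12(X+X^*)$ and let $$\omega_p(X)=\sup_{\theta\in\mathbb{R}}\bigl\|\mathrm{Re}(e^{i\theta}X)\bigr\|_p$$ be the Schatten $p$-generalized numerical radius of $X$. **Theorem.** Let $A,B\in M_n(\mathbb{C})$ and let $2\le p<\infty$ be a real number. Then $$\omega_p\left(\begin{bmatrix}0&A\\B&0\end{bmatrix}\right)\le 2^{1/p}\min\bigl(\omega_p(A),\omega_p(B)\bigr)+\min\bigl(\omega_p(A+B),\omega_p(A-B)\bigr),$$ where the block matrix on the left belongs to $M_{2n}(\mathbb{C})$. -/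

import Mathlib

open scoped ComplexStarModule

/-- The Schatten `p`-norm `(∑ⱼ sⱼ(A) ^ p) ^ (1 / p)` of a square complex matrix, where the
`sⱼ(A)` are the singular values of `A`, counted with multiplicity, as an operator on the
Euclidean space `ℂ ^ m`. -/
noncomputable def schattenNorm {m : Type*} [Fintype m] [DecidableEq m] (p : ℝ)
    (A : Matrix m m ℂ) : ℝ :=
  (∑ j ∈ Finset.range (Fintype.card m),
    (Matrix.toEuclideanLin A).singularValues j ^ p) ^ (1 / p)

/-- The Schatten `p`-generalized numerical radius
`ω_p(A) = sup_θ ‖Re(exp(iθ) A)‖_p`, where `Re(X) = (X + X*) / 2`. -/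
noncomputable def schattenNumericalRadius {m : Type*} [Fintype m] [DecidableEq m] (p : ℝ)
    (A : Matrix m m ℂ) : ℝ :=
  ⨆ θ : ℝ, schattenNorm p (ℜ (Complex.exp (θ * Complex.I) • A) : Matrix m m ℂ)

/-- The supremum in `schattenNumericalRadius` is that of a set bounded above. -/
theorem bddAbove_schattenNorm_realPart {m : Type*} [Fintype m] [DecidableEq m] {p : ℝ}
    (hp : 0 ≤ p) (A : Matrix m m ℂ) :
    BddAbove (Set.range fun θ : ℝ =>
      schattenNorm p (ℜ (Complex.exp (θ * Complex.I) • A) : Matrix m m ℂ)) := by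
  obtain ⟨C, hC⟩ : ∃ C : ℝ, ∀ (θ : ℝ) (v : EuclideanSpace ℂ m), ‖v‖ = 1 →
      ‖Matrix.toEuclideanLin
        (ℜ (Complex.exp (θ * Complex.I) • A) : Matrix m m ℂ) v‖ ≤ C := by
    refine ⟨2⁻¹ * (‖(Matrix.toEuclideanLin A).toContinuousLinearMap‖ +
      ‖(Matrix.toEuclideanLin (star A)).toContinuousLinearMap‖), fun θ v hv => ?_⟩
    have h1 := (Matrix.toEuclideanLin A).toContinuousLinearMap.le_opNorm v
    have h2 := (Matrix.toEuclideanLin (star A)).toContinuousLinearMap.le_opNorm v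
    rw [hv, mul_one, LinearMap.coe_toContinuousLinearMap'] at h1 h2
    have h3 : Matrix.toEuclideanLin (ℜ (Complex.exp (θ * Complex.I) • A) : Matrix m m ℂ) v =
        (2⁻¹ : ℂ) • (Complex.exp (θ * Complex.I) • Matrix.toEuclideanLin A v +
          star (Complex.exp (θ * Complex.I)) • Matrix.toEuclideanLin (star A) v) := by
      have h4 : (ℜ (Complex.exp (θ * Complex.I) • A) : Matrix m m ℂ) =
          (2⁻¹ : ℂ) • (Complex.exp (θ * Complex.I) • A +
            star (Complex.exp (θ * Complex.I)) • star A) := by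
        rw [realPart_apply_coe, star_smul]
        ext i j
        simp only [Matrix.smul_apply, Matrix.add_apply, smul_add]
        simp [Complex.real_smul]
      rw [h4]
      simp only [map_smul, map_add, LinearMap.smul_apply, LinearMap.add_apply]
    rw [h3, norm_smul]
    have h5 : ‖(2⁻¹ : ℂ)‖ = 2⁻¹ := by simp
    rw [h5]
    refine mul_le_mul_of_nonneg_left ((norm_add_le _ _).trans (add_le_add ?_ ?_)) (by norm_num)
    · rw [norm_smul, Complex.norm_exp_ofReal_mul_I, one_mul]
      exact h1
    · rw [norm_smul, norm_star, Complex.norm_exp_ofReal_mul_I, one_mul]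
      exact h2
  refine ⟨(∑ j ∈ Finset.range (Fintype.card m), C ^ p) ^ (1 / p), ?_⟩
  rintro _ ⟨θ, rfl⟩
  refine Real.rpow_le_rpow
    (Finset.sum_nonneg fun j _ => Real.rpow_nonneg (LinearMap.singularValues_nonneg _ _) _)
    (Finset.sum_le_sum fun j hj => ?_) (by positivity)
  refine Real.rpow_le_rpow (LinearMap.singularValues_nonneg _ _) ?_ hp
  set T := Matrix.toEuclideanLin (ℜ (Complex.exp (θ * Complex.I) • A) : Matrix m m ℂ)
  have hn : Module.finrank ℂ (EuclideanSpace ℂ m) = Fintype.card m := finrank_euclideanSpace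
  let i : Fin (Fintype.card m) := ⟨j, Finset.mem_range.1 hj⟩
  let v := T.isSymmetric_adjoint_comp_self.eigenvectorBasis hn i
  have hv : ‖v‖ = 1 := (T.isSymmetric_adjoint_comp_self.eigenvectorBasis hn).orthonormal.1 i
  have h1 : (T.adjoint ∘ₗ T) v = ((T.singularValues j ^ 2 : ℝ) : ℂ) • v := by
    rw [T.sq_singularValues_fin hn i]
    exact T.isSymmetric_adjoint_comp_self.apply_eigenvectorBasis hn i
  have h2 : T.singularValues j ^ 2 = ‖T v‖ ^ 2 := by
    have h3 : inner ℂ v ((T.adjoint ∘ₗ T) v) = ((‖T v‖ ^ 2 : ℝ) : ℂ) := by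
      rw [LinearMap.comp_apply, LinearMap.adjoint_inner_right, inner_self_eq_norm_sq_to_K]
      simp
    rw [h1, inner_smul_right, inner_self_eq_norm_sq_to_K, hv] at h3
    exact_mod_cast (by simpa using h3 :
      ((T.singularValues j : ℂ)) ^ 2 = (‖T v‖ : ℂ) ^ 2)
  rw [(pow_left_inj₀ (T.singularValues_nonneg j) (norm_nonneg _) two_ne_zero).1 h2]
  exact hC θ v hv

/-!
Write `Y(θ) = (exp(iθ) A + exp(-iθ) B*) / 2`. The real part of `exp(iθ) [0 A; B 0]` is the Hermitian
block matrix `[0 Y(θ); Y(θ)* 0]`, whose Schatten `p`-norm is `2 ^ (1 / p) * ‖Y(θ)‖_p`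
(`schattenNorm_fromBlocks_offDiag`). Up to a factor of modulus one and an adjoint, `Y(θ)` is the real
or imaginary part of `exp(iθ) A` (or of `exp(iθ) B`) plus half of `A - B` or `A + B`. The triangle
inequality therefore reduces the theorem to `2 ^ (1 / p - 1) * ‖X‖_p ≤ ω_p(X)`
(`two_rpow_mul_half_mul_schattenNorm_le`).

Everything about the norms rests on one variational fact, in which `p ≥ 2` is essential:
`∑ᵢ ‖X eᵢ‖ ^ p ≤ ‖X‖_p ^ p` for every orthonormal family `e`, with equality for an eigenbasis of
`X* X` (`sum_norm_rpow_le_schattenNorm_rpow`, `schattenNorm_rpow_eq_sum_norm`). Evaluating on an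
eigenbasis of `(X + Y)* (X + Y)` and using Minkowski's inequality for sums gives the triangle
inequality.

The lower bound for `ω_p` is a case of the Clarkson–McCarthy inequality. Let `G = X* X + X X*`, with
eigenvalues `gⱼ`. Applying the variational fact to the adjoint of the stacked matrix `[X 0; X* 0]`
yields `2 ‖X‖_p ^ p ≤ ∑ⱼ gⱼ ^ (p / 2)` (`two_mul_schattenNorm_rpow_le_sum`). On the other hand
`G = 2 (H² + K²)` for `X = H + iK` with `H`, `K` Hermitian, so convexity of `t ↦ t ^ (p / 2)` and the
variational fact for `H` and `K` bound that sum by `2 ^ (p - 1) (‖H‖_p ^ p + ‖K‖_p ^ p)`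
(`sum_roots_anticommutator_le`), hence by `2 ^ p * ω_p(X) ^ p`.
-/

open Matrix

/-! ### Real powers -/

theorem Real.rpow_eq_sq_rpow_half {x : ℝ} (hx : 0 ≤ x) (p : ℝ) : x ^ p = (x ^ 2) ^ (p / 2) := by
  rw [← Real.rpow_natCast_mul hx]
  congr 1
  push_cast
  ring

theorem Real.rpow_add_le_mul_rpow_add_rpow {x y q : ℝ} (hx : 0 ≤ x) (hy : 0 ≤ y) (hq : 1 ≤ q) :
    (x + y) ^ q ≤ 2 ^ (q - 1) * (x ^ q + y ^ q) := by
  lift x to NNReal using hx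
  lift y to NNReal using hy
  exact_mod_cast NNReal.rpow_add_le_mul_rpow_add_rpow x y hq

/-! ### Schatten norms and characteristic polynomials -/

theorem toEuclideanLin_conjTranspose_comp_self {m : Type*} [Fintype m] [DecidableEq m]
    (A : Matrix m m ℂ) :
    (toEuclideanLin A).adjoint ∘ₗ toEuclideanLin A = toEuclideanLin (Aᴴ * A) := by
  rw [← toEuclideanLin_conjTranspose_eq_adjoint]
  ext v i
  simp [toLpLin_apply, mulVec_mulVec]

theorem charpoly_toEuclideanLin {m : Type*} [Fintype m] [DecidableEq m]
    (A : Matrix m m ℂ) : (toEuclideanLin A).charpoly = A.charpoly := by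
  rw [toEuclideanLin_eq_toLin_orthonormal]
  exact charpoly_toLin A _

theorem schattenNorm_nonneg {m : Type*} [Fintype m] [DecidableEq m] (p : ℝ) (A : Matrix m m ℂ) :
    0 ≤ schattenNorm p A :=
  Real.rpow_nonneg (Finset.sum_nonneg fun _ _ =>
    Real.rpow_nonneg (LinearMap.singularValues_nonneg _ _) _) _

/-- Reading the norm off the characteristic polynomial of `A* A` makes its invariance under adjoints
and its behaviour on block matrices a matter of identities between characteristic polynomials. -/
theorem schattenNorm_rpow_eq_sum_roots {m : Type*} [Fintype m] [DecidableEq m] {p : ℝ}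
    (hp : 0 < p) (A : Matrix m m ℂ) :
    schattenNorm p A ^ p = ((Aᴴ * A).charpoly.roots.map fun z => z.re ^ (p / 2)).sum := by
  have hn : Module.finrank ℂ (EuclideanSpace ℂ m) = Fintype.card m := finrank_euclideanSpace
  rw [schattenNorm, ← Real.rpow_mul (Finset.sum_nonneg fun _ _ =>
    Real.rpow_nonneg (LinearMap.singularValues_nonneg _ _) _), one_div_mul_cancel hp.ne',
    Real.rpow_one, Finset.sum_range, ← charpoly_toEuclideanLin,
    ← toEuclideanLin_conjTranspose_comp_self,
    (toEuclideanLin A).isSymmetric_adjoint_comp_self.roots_charpoly_eq_eigenvalues hn,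
    Multiset.map_map]
  refine Finset.sum_congr rfl fun i _ => ?_
  simp only [Function.comp_apply]
  rw [← (toEuclideanLin A).sq_singularValues_fin hn i,
    Real.rpow_eq_sq_rpow_half (LinearMap.singularValues_nonneg _ _)]
  rfl

theorem schattenNorm_conjTranspose {m : Type*} [Fintype m] [DecidableEq m] {p : ℝ}
    (hp : 0 < p) (A : Matrix m m ℂ) : schattenNorm p Aᴴ = schattenNorm p A := by
  refine (Real.rpow_left_inj (schattenNorm_nonneg _ _) (schattenNorm_nonneg _ _) hp.ne').1 ?_
  rw [schattenNorm_rpow_eq_sum_roots hp, schattenNorm_rpow_eq_sum_roots hp,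
    conjTranspose_conjTranspose, charpoly_mul_comm]

theorem schattenNorm_fromBlocks_offDiag {m : Type*} [Fintype m] [DecidableEq m] {p : ℝ}
    (hp : 0 < p) (Y : Matrix m m ℂ) :
    schattenNorm p (fromBlocks 0 Y Yᴴ 0) = 2 ^ (1 / p) * schattenNorm p Y := by
  have h0 := schattenNorm_nonneg p Y
  refine (Real.rpow_left_inj (schattenNorm_nonneg _ _) (by positivity) hp.ne').1 ?_
  rw [Real.mul_rpow (by positivity) h0, ← Real.rpow_mul (by norm_num),
    one_div_mul_cancel hp.ne', Real.rpow_one, schattenNorm_rpow_eq_sum_roots hp,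
    schattenNorm_rpow_eq_sum_roots hp, fromBlocks_conjTranspose, fromBlocks_multiply]
  simp only [conjTranspose_zero, conjTranspose_conjTranspose, Matrix.zero_mul, Matrix.mul_zero,
    zero_add, add_zero]
  rw [charpoly_fromBlocks_zero₁₂, Polynomial.roots_mul
    (mul_ne_zero (charpoly_monic _).ne_zero (charpoly_monic _).ne_zero), Multiset.map_add,
    Multiset.sum_add, charpoly_mul_comm Y, two_mul]

theorem sum_eigenvalues_eq_sum_roots {m : Type*} [Fintype m] [DecidableEq m] {G : Matrix m m ℂ}
    (hG : G.IsHermitian) (f : ℝ → ℝ) :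
    ∑ i, f (hG.eigenvalues i) = (G.charpoly.roots.map fun z => f z.re).sum := by
  rw [hG.roots_charpoly_eq_eigenvalues, Multiset.map_map]
  rfl

/-! ### Images of vectors and eigenbases -/

theorem inner_toEuclideanLin_conjTranspose_mul_self {m : Type*} [Fintype m] [DecidableEq m]
    (A : Matrix m m ℂ) (v : EuclideanSpace ℂ m) :
    inner ℂ v (toEuclideanLin (Aᴴ * A) v) = ((‖toEuclideanLin A v‖ ^ 2 : ℝ) : ℂ) := by
  rw [← toEuclideanLin_conjTranspose_comp_self, LinearMap.comp_apply,
    LinearMap.adjoint_inner_right, inner_self_eq_norm_sq_to_K]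
  simp

theorem toEuclideanLin_eigenvectorBasis {m : Type*} [Fintype m] [DecidableEq m] {G : Matrix m m ℂ}
    (hG : G.IsHermitian) (j : m) :
    toEuclideanLin G (hG.eigenvectorBasis j) = (hG.eigenvalues j : ℂ) • hG.eigenvectorBasis j := by
  ext i
  have := congrFun (hG.mulVec_eigenvectorBasis j) i
  simpa [toLpLin_apply] using this

/-! ### Variational characterization for `p ≥ 2` -/

theorem norm_sq_toEuclideanLin {m : Type*} [Fintype m] [DecidableEq m]
    (A : Matrix m m ℂ) (v : EuclideanSpace ℂ m) :
    ‖toEuclideanLin A v‖ ^ 2 = ∑ j, (isHermitian_conjTranspose_mul_self A).eigenvalues j *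
      ‖inner ℂ ((isHermitian_conjTranspose_mul_self A).eigenvectorBasis j) v‖ ^ 2 := by
  set hG := isHermitian_conjTranspose_mul_self A
  have h := inner_toEuclideanLin_conjTranspose_mul_self A v
  have hs : (toEuclideanLin (Aᴴ * A)).IsSymmetric := by
    rw [← toEuclideanLin_conjTranspose_comp_self]
    exact (toEuclideanLin A).isSymmetric_adjoint_comp_self
  rw [← OrthonormalBasis.sum_inner_mul_inner hG.eigenvectorBasis] at h
  rw [← Complex.ofReal_inj, ← h]
  push_cast
  refine Finset.sum_congr rfl fun j _ => ?_
  rw [← hs, toEuclideanLin_eigenvectorBasis, inner_smul_left, ← Complex.conj_mul',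
    inner_conj_symm]
  simp
  ring

theorem norm_sq_toEuclideanLin_eigenvectorBasis {m : Type*} [Fintype m] [DecidableEq m]
    (A : Matrix m m ℂ) (j : m) :
    ‖toEuclideanLin A ((isHermitian_conjTranspose_mul_self A).eigenvectorBasis j)‖ ^ 2 =
      (isHermitian_conjTranspose_mul_self A).eigenvalues j := by
  have h := inner_toEuclideanLin_conjTranspose_mul_self A
    ((isHermitian_conjTranspose_mul_self A).eigenvectorBasis j)
  rw [toEuclideanLin_eigenvectorBasis, inner_smul_right, inner_self_eq_norm_sq_to_K,
    OrthonormalBasis.norm_eq_one] at h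
  exact_mod_cast (by simpa using h.symm :
    (‖toEuclideanLin A ((isHermitian_conjTranspose_mul_self A).eigenvectorBasis j)‖ : ℂ) ^ 2 =
      (isHermitian_conjTranspose_mul_self A).eigenvalues j)

theorem schattenNorm_rpow_eq_sum_norm {m : Type*} [Fintype m] [DecidableEq m] {p : ℝ}
    (hp : 0 < p) (A : Matrix m m ℂ) :
    schattenNorm p A ^ p =
      ∑ j, ‖toEuclideanLin A ((isHermitian_conjTranspose_mul_self A).eigenvectorBasis j)‖ ^ p := by
  rw [schattenNorm_rpow_eq_sum_roots hp,
    ← sum_eigenvalues_eq_sum_roots (isHermitian_conjTranspose_mul_self A) (· ^ (p / 2))]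
  refine Finset.sum_congr rfl fun j _ => ?_
  rw [← norm_sq_toEuclideanLin_eigenvectorBasis, ← Real.rpow_eq_sq_rpow_half (norm_nonneg _)]

/-- Expand `‖A eᵢ‖²` in an eigenbasis `v` of `A* A`: it is an average of the eigenvalues with weights
`|⟨vⱼ, eᵢ⟩|²`, so Jensen's inequality for `t ↦ t ^ (p / 2)` applies (this needs `2 ≤ p`), and Bessel's
inequality bounds the total weight that each eigenvalue receives. -/
theorem sum_norm_rpow_le_schattenNorm_rpow {m ι : Type*} [Fintype m] [DecidableEq m] [Fintype ι]
    {p : ℝ} (hp : 2 ≤ p) (A : Matrix m m ℂ) {e : ι → EuclideanSpace ℂ m} (he : Orthonormal ℂ e) :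
    ∑ i, ‖toEuclideanLin A (e i)‖ ^ p ≤ schattenNorm p A ^ p := by
  set hG := isHermitian_conjTranspose_mul_self A
  have hg : ∀ j, 0 ≤ hG.eigenvalues j := fun j => by
    rw [← norm_sq_toEuclideanLin_eigenvectorBasis]; positivity
  rw [schattenNorm_rpow_eq_sum_roots (by linarith), ← sum_eigenvalues_eq_sum_roots hG (· ^ (p / 2))]
  calc ∑ i, ‖toEuclideanLin A (e i)‖ ^ p
      ≤ ∑ i, ∑ j, ‖inner ℂ (hG.eigenvectorBasis j) (e i)‖ ^ 2 * hG.eigenvalues j ^ (p / 2) := by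
        refine Finset.sum_le_sum fun i _ => ?_
        rw [Real.rpow_eq_sq_rpow_half (norm_nonneg _), norm_sq_toEuclideanLin]
        simp_rw [mul_comm (hG.eigenvalues _)]
        refine Real.rpow_arith_mean_le_arith_mean_rpow _ _ _ (fun _ _ => by positivity) ?_
          (fun j _ => hg j) (by linarith)
        rw [hG.eigenvectorBasis.sum_sq_norm_inner_right, he.1 i, one_pow]
    _ = ∑ j, (∑ i, ‖inner ℂ (e i) (hG.eigenvectorBasis j)‖ ^ 2) * hG.eigenvalues j ^ (p / 2) := by
        rw [Finset.sum_comm]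
        simp_rw [Finset.sum_mul, norm_inner_symm]
    _ ≤ ∑ j, hG.eigenvalues j ^ (p / 2) := by
        refine Finset.sum_le_sum fun j _ =>
          mul_le_of_le_one_left (Real.rpow_nonneg (hg j) _) ?_
        have := he.sum_inner_products_le (hG.eigenvectorBasis j) (s := Finset.univ)
        rwa [OrthonormalBasis.norm_eq_one, one_pow] at this

/-! ### The Schatten norm as a norm -/

/-- Minkowski's inequality for the norms of the images of an orthonormal basis that computes
`‖A + B‖_p` and only bounds `‖A‖_p` and `‖B‖_p` from below. -/
theorem schattenNorm_add_le {m : Type*} [Fintype m] [DecidableEq m] {p : ℝ} (hp : 2 ≤ p)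
    (A B : Matrix m m ℂ) :
    schattenNorm p (A + B) ≤ schattenNorm p A + schattenNorm p B := by
  have hp0 : 0 < p := by linarith
  set u := (isHermitian_conjTranspose_mul_self (A + B)).eigenvectorBasis
  have key : ∀ M : Matrix m m ℂ,
      (∑ j, ‖toEuclideanLin M (u j)‖ ^ p) ^ (1 / p) ≤ schattenNorm p M := fun M => by
    rw [one_div, Real.rpow_inv_le_iff_of_pos
      (Finset.sum_nonneg fun _ _ => Real.rpow_nonneg (norm_nonneg _) _)
      (schattenNorm_nonneg _ _) hp0]
    exact sum_norm_rpow_le_schattenNorm_rpow hp M u.orthonormal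
  calc schattenNorm p (A + B)
      = (∑ j, ‖toEuclideanLin (A + B) (u j)‖ ^ p) ^ (1 / p) := by
        rw [← schattenNorm_rpow_eq_sum_norm hp0, one_div,
          Real.rpow_rpow_inv (schattenNorm_nonneg _ _) hp0.ne']
    _ ≤ (∑ j, (‖toEuclideanLin A (u j)‖ + ‖toEuclideanLin B (u j)‖) ^ p) ^ (1 / p) := by
        gcongr with j
        rw [map_add]
        exact norm_add_le _ _
    _ ≤ (∑ j, ‖toEuclideanLin A (u j)‖ ^ p) ^ (1 / p) +
          (∑ j, ‖toEuclideanLin B (u j)‖ ^ p) ^ (1 / p) :=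
        Real.Lp_add_le_of_nonneg _ (by linarith) (fun _ _ => norm_nonneg _)
          (fun _ _ => norm_nonneg _)
    _ ≤ _ := add_le_add (key A) (key B)

theorem schattenNorm_smul_le {m : Type*} [Fintype m] [DecidableEq m] {p : ℝ} (hp : 2 ≤ p)
    (c : ℂ) (A : Matrix m m ℂ) : schattenNorm p (c • A) ≤ ‖c‖ * schattenNorm p A := by
  have hp0 : 0 < p := by linarith
  refine (Real.rpow_le_rpow_iff (schattenNorm_nonneg _ _)
    (mul_nonneg (norm_nonneg _) (schattenNorm_nonneg _ _)) hp0).1 ?_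
  rw [schattenNorm_rpow_eq_sum_norm hp0, Real.mul_rpow (norm_nonneg _) (schattenNorm_nonneg _ _)]
  simp_rw [map_smul, LinearMap.smul_apply, norm_smul, Real.mul_rpow (norm_nonneg c) (norm_nonneg _)]
  rw [← Finset.mul_sum]
  gcongr
  exact sum_norm_rpow_le_schattenNorm_rpow hp A (OrthonormalBasis.orthonormal _)

/-! ### A Clarkson–McCarthy inequality -/

theorem orthonormal_sumElim_toLp {m n : Type*} [Fintype m] [Fintype n] {ι κ : Type*}
    {e : ι → EuclideanSpace ℂ m} {f : κ → EuclideanSpace ℂ n}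
    (he : Orthonormal ℂ e) (hf : Orthonormal ℂ f) :
    Orthonormal ℂ (Sum.elim (fun i => WithLp.toLp 2 (Sum.elim (e i) 0))
      (fun i => WithLp.toLp 2 (Sum.elim 0 (f i))) : ι ⊕ κ → EuclideanSpace ℂ (m ⊕ n)) := by
  classical
  rw [orthonormal_iff_ite] at he hf ⊢
  simp only [PiLp.inner_apply] at he hf
  rintro (i | i) (j | j) <;> simp [PiLp.inner_apply, Fintype.sum_sum_type]
  · simpa using he i j
  · simpa using hf i j

theorem norm_toLp_sumElim_zero {m n : Type*} [Fintype m] [Fintype n] (v : EuclideanSpace ℂ m) :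
    ‖(WithLp.toLp 2 (Sum.elim v 0) : EuclideanSpace ℂ (m ⊕ n))‖ = ‖v‖ := by
  simp [EuclideanSpace.norm_eq, Fintype.sum_sum_type]

/-- Half of the Clarkson–McCarthy inequality: the right-hand side is `tr (X* X + X X*) ^ (p / 2)`.
It is the `p`-th power of the norm of `[X 0; X* 0]`, a square version of the column `[X; X*]`, and
hence of its adjoint `[X* X; 0 0]`. The latter is tested on an eigenbasis of `X X*` in the first
summand together with an eigenbasis of `X* X` in the second. -/
theorem two_mul_schattenNorm_rpow_le_sum {m : Type*} [Fintype m] [DecidableEq m] {p : ℝ}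
    (hp : 2 ≤ p) (X : Matrix m m ℂ) :
    2 * schattenNorm p X ^ p ≤
      ((Xᴴ * X + X * Xᴴ).charpoly.roots.map fun z => z.re ^ (p / 2)).sum := by
  have hp0 : 0 < p := by linarith
  set e := (isHermitian_conjTranspose_mul_self X).eigenvectorBasis
  set f := (isHermitian_conjTranspose_mul_self Xᴴ).eigenvectorBasis
  set Z : Matrix (m ⊕ m) (m ⊕ m) ℂ := fromBlocks X 0 Xᴴ 0
  have hZ : schattenNorm p Zᴴ ^ p =
      ((Xᴴ * X + X * Xᴴ).charpoly.roots.map fun z => z.re ^ (p / 2)).sum := by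
    rw [schattenNorm_conjTranspose hp0, schattenNorm_rpow_eq_sum_roots hp0,
      fromBlocks_conjTranspose, fromBlocks_multiply]
    simp only [conjTranspose_zero, conjTranspose_conjTranspose, Matrix.zero_mul, Matrix.mul_zero,
      add_zero]
    rw [charpoly_fromBlocks_zero₁₂, Polynomial.roots_mul
      (mul_ne_zero (charpoly_monic _).ne_zero (charpoly_monic _).ne_zero), Multiset.map_add,
      Multiset.sum_add, charpoly_zero]
    simp [Multiset.map_nsmul, Multiset.sum_nsmul, Real.zero_rpow (by linarith : p / 2 ≠ 0)]
  have h := sum_norm_rpow_le_schattenNorm_rpow hp Zᴴ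
    (orthonormal_sumElim_toLp f.orthonormal e.orthonormal)
  have h1 : ∀ v, toEuclideanLin Zᴴ (WithLp.toLp 2 (Sum.elim v 0)) =
      WithLp.toLp 2 (Sum.elim (toEuclideanLin Xᴴ (WithLp.toLp 2 v)) 0) := fun v => by
    simp [Z, fromBlocks_conjTranspose, toLpLin_apply, fromBlocks_mulVec]
  have h2 : ∀ v, toEuclideanLin Zᴴ (WithLp.toLp 2 (Sum.elim 0 v)) =
      WithLp.toLp 2 (Sum.elim (toEuclideanLin X (WithLp.toLp 2 v)) 0) := fun v => by
    simp [Z, fromBlocks_conjTranspose, toLpLin_apply, fromBlocks_mulVec]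
  simp only [Fintype.sum_sum_type, Sum.elim_inl, Sum.elim_inr, h1, h2, norm_toLp_sumElim_zero,
    WithLp.toLp_ofLp] at h
  rwa [← schattenNorm_rpow_eq_sum_norm hp0, ← schattenNorm_rpow_eq_sum_norm hp0, hZ,
    schattenNorm_conjTranspose hp0, ← two_mul] at h

/-- The other half of the Clarkson–McCarthy inequality: `X* X + X X*` equals `2 (H² + K²)` for the
Hermitian parts `H` and `K` of `X`, and each eigenvalue is split between `H` and `K` by convexity of
`t ↦ t ^ (p / 2)`. -/
theorem sum_roots_anticommutator_le {m : Type*} [Fintype m] [DecidableEq m] {p : ℝ}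
    (hp : 2 ≤ p) (X : Matrix m m ℂ) :
    ((Xᴴ * X + X * Xᴴ).charpoly.roots.map fun z => z.re ^ (p / 2)).sum ≤
      2 ^ (p - 1) * (schattenNorm p (ℜ X : Matrix m m ℂ) ^ p +
        schattenNorm p (ℑ X : Matrix m m ℂ) ^ p) := by
  have hG : (Xᴴ * X + X * Xᴴ).IsHermitian :=
    (isHermitian_conjTranspose_mul_self X).add (isHermitian_mul_conjTranspose_self X)
  set H : Matrix m m ℂ := (ℜ X : Matrix m m ℂ)
  set K : Matrix m m ℂ := (ℑ X : Matrix m m ℂ)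
  have hHs : Hᴴ = H := (ℜ X).2
  have hKs : Kᴴ = K := (ℑ X).2
  have hX : X = H + Complex.I • K := (realPart_add_I_smul_imaginaryPart X).symm
  have hGHK : Xᴴ * X + X * Xᴴ = (2 : ℂ) • (Hᴴ * H + Kᴴ * K) := by
    rw [hX, conjTranspose_add, conjTranspose_smul, hHs, hKs]
    simp only [Matrix.add_mul, Matrix.mul_add, Matrix.smul_mul, Matrix.mul_smul, smul_smul,
      smul_add, two_smul]
    simp
    abel
  have hg : ∀ j, hG.eigenvalues j = 2 * (‖toEuclideanLin H (hG.eigenvectorBasis j)‖ ^ 2 +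
      ‖toEuclideanLin K (hG.eigenvectorBasis j)‖ ^ 2) := fun j => by
    have h : inner ℂ (hG.eigenvectorBasis j)
        (toEuclideanLin (Xᴴ * X + X * Xᴴ) (hG.eigenvectorBasis j)) = (hG.eigenvalues j : ℂ) := by
      rw [toEuclideanLin_eigenvectorBasis, inner_smul_right, inner_self_eq_norm_sq_to_K,
        OrthonormalBasis.norm_eq_one]
      simp
    have h' := congrArg (fun M => inner ℂ (hG.eigenvectorBasis j)
      (toEuclideanLin M (hG.eigenvectorBasis j))) hGHK
    simp only [map_smul, map_add, LinearMap.smul_apply, LinearMap.add_apply, inner_smul_right,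
      inner_add_right, inner_toEuclideanLin_conjTranspose_mul_self] at h h'
    rw [h] at h'
    exact_mod_cast h'
  rw [← sum_eigenvalues_eq_sum_roots hG (· ^ (p / 2))]
  calc ∑ j, hG.eigenvalues j ^ (p / 2)
      ≤ ∑ j, 2 ^ (p - 1) * (‖toEuclideanLin H (hG.eigenvectorBasis j)‖ ^ p +
          ‖toEuclideanLin K (hG.eigenvectorBasis j)‖ ^ p) := by
        refine Finset.sum_le_sum fun j _ => ?_
        rw [hg, Real.mul_rpow (by norm_num) (by positivity),
          Real.rpow_eq_sq_rpow_half (norm_nonneg (toEuclideanLin H _)),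
          Real.rpow_eq_sq_rpow_half (norm_nonneg (toEuclideanLin K _)),
          show p - 1 = p / 2 + (p / 2 - 1) by ring, Real.rpow_add two_pos, mul_assoc]
        gcongr
        exact Real.rpow_add_le_mul_rpow_add_rpow (by positivity) (by positivity) (by linarith)
    _ ≤ _ := by
        rw [← Finset.mul_sum, Finset.sum_add_distrib]
        gcongr
        · exact sum_norm_rpow_le_schattenNorm_rpow hp H hG.eigenvectorBasis.orthonormal
        · exact sum_norm_rpow_le_schattenNorm_rpow hp K hG.eigenvectorBasis.orthonormal

/-! ### The numerical radius -/

theorem schattenNorm_realPart_le_schattenNumericalRadius {m : Type*} [Fintype m] [DecidableEq m]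
    {p : ℝ} (hp : 0 ≤ p) (A : Matrix m m ℂ) (θ : ℝ) :
    schattenNorm p (ℜ (Complex.exp (θ * Complex.I) • A) : Matrix m m ℂ) ≤
      schattenNumericalRadius p A :=
  le_ciSup (bddAbove_schattenNorm_realPart hp A) θ

/-- The imaginary part of `exp(iθ) A` is minus the real part of `exp(i(θ + π / 2)) A`. -/
theorem schattenNorm_imaginaryPart_le_schattenNumericalRadius {m : Type*} [Fintype m]
    [DecidableEq m] {p : ℝ} (hp : 2 ≤ p) (A : Matrix m m ℂ) (θ : ℝ) :
    schattenNorm p (ℑ (Complex.exp (θ * Complex.I) • A) : Matrix m m ℂ) ≤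
      schattenNumericalRadius p A := by
  refine le_trans ?_ (schattenNorm_realPart_le_schattenNumericalRadius (by linarith : 0 ≤ p) A
    (θ + Real.pi / 2))
  have h : Complex.exp ((θ + Real.pi / 2 : ℝ) * Complex.I) • A =
      Complex.I • (Complex.exp (θ * Complex.I) • A) := by
    rw [smul_smul]
    push_cast
    rw [add_mul, Complex.exp_add, Complex.exp_pi_div_two_mul_I, mul_comm]
  rw [h, realPart_I_smul]
  simpa using schattenNorm_smul_le hp (-1)
    (-ℑ (Complex.exp (θ * Complex.I) • A) : Matrix m m ℂ)

/-- The sharp comparison `‖X‖_p ≤ 2 ^ (1 - 1 / p) * ω_p(X)`, written with the factor `2⁻¹` apart, as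
it arises from the off-diagonal blocks. -/
theorem two_rpow_mul_half_mul_schattenNorm_le {m : Type*} [Fintype m] [DecidableEq m]
    {p : ℝ} (hp : 2 ≤ p) (X : Matrix m m ℂ) :
    2 ^ (1 / p) * (2⁻¹ * schattenNorm p X) ≤ schattenNumericalRadius p X := by
  have hp0 : 0 < p := by linarith
  have hX := schattenNorm_nonneg p X
  have hR := schattenNorm_realPart_le_schattenNumericalRadius hp0.le X 0
  have hI := schattenNorm_imaginaryPart_le_schattenNumericalRadius hp X 0
  simp only [Complex.ofReal_zero, zero_mul, Complex.exp_zero, one_smul] at hR hI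
  have hω : 0 ≤ schattenNumericalRadius p X := (schattenNorm_nonneg _ _).trans hR
  refine (Real.rpow_le_rpow_iff (by positivity) hω hp0).1 ?_
  have h := (two_mul_schattenNorm_rpow_le_sum hp X).trans (sum_roots_anticommutator_le hp X)
  have hR' := Real.rpow_le_rpow (schattenNorm_nonneg _ _) hR hp0.le
  have hI' := Real.rpow_le_rpow (schattenNorm_nonneg _ _) hI hp0.le
  have h2 : (0 : ℝ) < 2 ^ p := by positivity
  rw [Real.rpow_sub_one two_ne_zero] at h
  rw [Real.mul_rpow (by positivity) (by positivity), Real.mul_rpow (by positivity) hX,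
    ← Real.rpow_mul (by norm_num), one_div_mul_cancel hp0.ne', Real.rpow_one,
    Real.inv_rpow (by norm_num), mul_left_comm, inv_mul_le_iff₀ h2]
  -- Both Hermitian parts have norm at most `ω_p(X)`.
  refine h.trans ?_
  rw [div_mul_eq_mul_div, mul_div_assoc]
  gcongr
  linarith

theorem coe_realPart_eq {m : Type*} (X : Matrix m m ℂ) :
    (ℜ X : Matrix m m ℂ) = (2⁻¹ : ℂ) • (X + Xᴴ) := by
  rw [realPart_apply_coe]
  ext i j
  simp [Complex.real_smul, star_eq_conjTranspose, mul_add]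

theorem I_smul_coe_imaginaryPart_eq {m : Type*} (X : Matrix m m ℂ) :
    Complex.I • (ℑ X : Matrix m m ℂ) = (2⁻¹ : ℂ) • (X - Xᴴ) := by
  rw [imaginaryPart_apply_coe]
  ext i j
  simp [Complex.real_smul, star_eq_conjTranspose, ← mul_assoc]

theorem realPart_fromBlocks_offDiag {m : Type*} (A B : Matrix m m ℂ) :
    (ℜ (fromBlocks 0 A B 0) : Matrix (m ⊕ m) (m ⊕ m) ℂ) =
      fromBlocks 0 ((2⁻¹ : ℂ) • (A + Bᴴ)) ((2⁻¹ : ℂ) • (A + Bᴴ))ᴴ 0 := by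
  rw [coe_realPart_eq, fromBlocks_conjTranspose, fromBlocks_add, fromBlocks_smul]
  simp [add_comm]

/-- The bound that results from splitting, for each `θ`, the off-diagonal block of the real part of
`exp(iθ) [0 A; B 0]` into a part of norm at most `w` and half of a matrix no larger than `X`. -/
theorem schattenNumericalRadius_fromBlocks_le {m : Type*} [Fintype m] [DecidableEq m]
    {p : ℝ} (hp : 2 ≤ p) {A B X : Matrix m m ℂ} {w : ℝ}
    (h : ∀ θ : ℝ, ∃ U V : Matrix m m ℂ, schattenNorm p U ≤ w ∧ schattenNorm p V ≤ schattenNorm p X ∧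
      (2⁻¹ : ℂ) • (Complex.exp (θ * Complex.I) • A + (Complex.exp (θ * Complex.I) • B)ᴴ) =
        U + (2⁻¹ : ℂ) • V) :
    schattenNumericalRadius p (fromBlocks 0 A B 0) ≤
      2 ^ (1 / p) * w + schattenNumericalRadius p X := by
  refine ciSup_le fun θ => ?_
  obtain ⟨U, V, hU, hV, hUV⟩ := h θ
  rw [fromBlocks_smul, smul_zero, realPart_fromBlocks_offDiag,
    schattenNorm_fromBlocks_offDiag (by linarith), hUV]
  have h1 := schattenNorm_add_le hp U ((2⁻¹ : ℂ) • V)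
  have h2 := schattenNorm_smul_le hp (2⁻¹ : ℂ) V
  rw [norm_inv, Complex.norm_ofNat] at h2
  calc 2 ^ (1 / p) * schattenNorm p (U + (2⁻¹ : ℂ) • V)
      ≤ 2 ^ (1 / p) * (w + 2⁻¹ * schattenNorm p X) := by
        gcongr
        linarith
    _ = 2 ^ (1 / p) * w + 2 ^ (1 / p) * (2⁻¹ * schattenNorm p X) := mul_add _ _ _
    _ ≤ _ := by
        gcongr
        exact two_rpow_mul_half_mul_schattenNorm_le hp X

theorem schattenNorm_unit_smul_le {m : Type*} [Fintype m] [DecidableEq m] {p : ℝ} (hp : 2 ≤ p)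
    {c : ℂ} (hc : ‖c‖ = 1) (A : Matrix m m ℂ) : schattenNorm p (c • A) ≤ schattenNorm p A := by
  simpa [hc] using schattenNorm_smul_le hp c A

theorem schattenNumericalRadius_fromBlocks_le_left_sub {m : Type*} [Fintype m] [DecidableEq m]
    {p : ℝ} (hp : 2 ≤ p) (A B : Matrix m m ℂ) :
    schattenNumericalRadius p (fromBlocks 0 A B 0) ≤
      2 ^ (1 / p) * schattenNumericalRadius p A + schattenNumericalRadius p (A - B) := by
  refine schattenNumericalRadius_fromBlocks_le hp fun θ => ⟨_,
    (-Complex.exp (θ * Complex.I) • (A - B))ᴴ,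
    schattenNorm_realPart_le_schattenNumericalRadius (by linarith) A θ, ?_, ?_⟩
  · rw [schattenNorm_conjTranspose (by linarith)]
    exact schattenNorm_unit_smul_le hp (by rw [norm_neg, Complex.norm_exp_ofReal_mul_I]) _
  · rw [coe_realPart_eq, ← smul_add]
    simp only [conjTranspose_smul, conjTranspose_sub, star_neg]
    module

theorem schattenNumericalRadius_fromBlocks_le_left_add {m : Type*} [Fintype m] [DecidableEq m]
    {p : ℝ} (hp : 2 ≤ p) (A B : Matrix m m ℂ) :
    schattenNumericalRadius p (fromBlocks 0 A B 0) ≤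
      2 ^ (1 / p) * schattenNumericalRadius p A + schattenNumericalRadius p (A + B) := by
  refine schattenNumericalRadius_fromBlocks_le hp fun θ => ⟨_,
    (Complex.exp (θ * Complex.I) • (A + B))ᴴ,
    (schattenNorm_unit_smul_le hp Complex.norm_I _).trans
      (schattenNorm_imaginaryPart_le_schattenNumericalRadius hp A θ), ?_, ?_⟩
  · rw [schattenNorm_conjTranspose (by linarith)]
    exact schattenNorm_unit_smul_le hp (Complex.norm_exp_ofReal_mul_I θ) _
  · rw [I_smul_coe_imaginaryPart_eq, ← smul_add]
    simp only [conjTranspose_smul, conjTranspose_add]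
    module

theorem schattenNumericalRadius_fromBlocks_le_right_sub {m : Type*} [Fintype m] [DecidableEq m]
    {p : ℝ} (hp : 2 ≤ p) (A B : Matrix m m ℂ) :
    schattenNumericalRadius p (fromBlocks 0 A B 0) ≤
      2 ^ (1 / p) * schattenNumericalRadius p B + schattenNumericalRadius p (A - B) := by
  refine schattenNumericalRadius_fromBlocks_le hp fun θ => ⟨_,
    Complex.exp (θ * Complex.I) • (A - B),
    schattenNorm_realPart_le_schattenNumericalRadius (by linarith) B θ,
    schattenNorm_unit_smul_le hp (Complex.norm_exp_ofReal_mul_I θ) _, ?_⟩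
  rw [coe_realPart_eq, ← smul_add]
  simp only [conjTranspose_smul]
  module

theorem schattenNumericalRadius_fromBlocks_le_right_add {m : Type*} [Fintype m] [DecidableEq m]
    {p : ℝ} (hp : 2 ≤ p) (A B : Matrix m m ℂ) :
    schattenNumericalRadius p (fromBlocks 0 A B 0) ≤
      2 ^ (1 / p) * schattenNumericalRadius p B + schattenNumericalRadius p (A + B) := by
  refine schattenNumericalRadius_fromBlocks_le hp fun θ => ⟨-Complex.I • _,
    Complex.exp (θ * Complex.I) • (A + B), (schattenNorm_unit_smul_le hp (by simp) _).trans
      (schattenNorm_imaginaryPart_le_schattenNumericalRadius hp B θ),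
    schattenNorm_unit_smul_le hp (Complex.norm_exp_ofReal_mul_I θ) _, ?_⟩
  rw [neg_smul, I_smul_coe_imaginaryPart_eq]
  simp only [conjTranspose_smul]
  module

theorem mainTheorem3 (n : ℕ) (A B : Matrix (Fin n) (Fin n) ℂ) (p : ℝ) (hp : 2 ≤ p) :
    schattenNumericalRadius p (Matrix.fromBlocks 0 A B 0) ≤
      2 ^ (1 / p) * min (schattenNumericalRadius p A) (schattenNumericalRadius p B) +
        min (schattenNumericalRadius p (A + B)) (schattenNumericalRadius p (A - B)) := by
  rcases min_choice (schattenNumericalRadius p A) (schattenNumericalRadius p B) with h | h <;>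
    rcases min_choice (schattenNumericalRadius p (A + B)) (schattenNumericalRadius p (A - B))
      with h' | h' <;> rw [h, h']
  · exact schattenNumericalRadius_fromBlocks_le_left_add hp A B
  · exact schattenNumericalRadius_fromBlocks_le_left_sub hp A B
  · exact schattenNumericalRadius_fromBlocks_le_right_add hp A B
  · exact schattenNumericalRadius_fromBlocks_le_right_sub hp A B
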